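/- Let $(\mathsf{A}_k,\phi_k)_{k\ge 1}$ be a sequence of von Neumann algebras equipped with normal faithful states, and let $(\mathcal{A},\phi)=*_k(\mathsf{A}_k,\phi_k)$ be their reduced free product von Neumann algebra (amalgamated over $\mathbb{C}$), with the filtration $\mathcal{A}_n=\mathsf{A}_1*\cdots*\mathsf{A}_n\subseteq\mathcal{A}$ and the $\phi$-preserving conditional expectations $\mathsf{E}_n:\mathcal{A}\to\mathcal{A}_n$. A free martingale in $L_\infty(\mathcal{A})=\mathcal{A}$ is a sequence $x=(x_n)_{n\ge1}$ with $x_n\in\mathcal{A}_n$ and $\mathsf{E}_n(x_m)=x_n$ for $n\le m$; its differences are $dx_1=x_1$ and $dx_k=x_k-x_{k-1}$ for $k\ge2$. For $n\ge1$ let $\mathcal{K}_n(\mathcal{A})$ be the best (i.e. smallest) constant such that $$\max\left\{\Big\|\Big(\sum_{k=1}^{2n}dx_k\,dx_k^*\Big)^{1/2}\Big\|_\infty,\ \Big\|\Big(\sum_{k=1}^{2n}dx_k^*\,dx_k\Big)^{1/2}\Big\|_\infty\right\}\le \mathcal{K}_n(\mathcal{A})\,\Big\|\sum_{k=1}^{2n}dx_k\Big\|_\infty$$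 for all free martingales $x$ in $L_\infty(\mathcal{A})$, and let $\mathcal{K}_n$ be the best constant for which the same estimate holds for all free martingales in all such reduced free products. Then there is an absolute constant $c>0$ such that $\mathcal{K}_n\ge c\log n$ for all $n\ge1$. Moreover, there is a single sequence $(\mathsf{A}_k,\phi_k)_{k\ge1}$ whose reduced free product $\mathcal{A}$ satisfies $\mathcal{K}_n(\mathcal{A})\ge c\log n$ for all $n\ge1$; in particular no finite constant makes the above estimate valid for all $n$ and all free martingales in $L_\infty(\mathcal{A})$, so the free Burkholder–Gundy inequality fails in $L_\infty(\mathcal{A})$. -/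

import Mathlib

open scoped NNReal ENNReal

noncomputable section

/-- A von Neumann algebra with a distinguished normal faithful state, in its GNS representation:
a von Neumann algebra `alg` acting on `H = L₂(alg)` together with a unit vector `vac` which is
cyclic and separating, the state being `φ(a) = ⟪vac, a vac⟫`.  By the GNS construction every von
Neumann algebra with a normal faithful state is of this form, uniquely up to unitary equivalence.
The record also contains an orthonormal basis of `H` of the form `{vac} ∪ {e i : i ∈ ι}`, so that
`(e i)` is an orthonormal basis of the closure of the mean-zero elements; it serves to write down
the tensor products in the free product Hilbert space. -/
structure VNState where
  H : Type
  [normed : NormedAddCommGroup H]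
  [inner : InnerProductSpace ℂ H]
  [complete : CompleteSpace H]
  alg : VonNeumannAlgebra H
  ι : Type
  basis : HilbertBasis (Option ι) ℂ H
  cyclic : Dense {v : H | ∃ a ∈ alg, v = a (basis none)}
  separating : ∀ a ∈ alg, a (basis none) = 0 → a = 0

attribute [instance] VNState.normed VNState.inner VNState.complete

/-- The unit vector implementing the state. -/
def VNState.vac (M : VNState) : M.H := M.basis none

namespace FreeProd

/-- Reduced words `(k₁, i₁) (k₂, i₂) ⋯ (k_m, i_m)`, `k₁ ≠ k₂ ≠ ⋯ ≠ k_m`, standing for the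
elementary tensors `e_{i₁} ⊗ ⋯ ⊗ e_{i_m}` of basis vectors of `L₂` of the mean-zero parts. -/
def Word (F : ℕ → VNState) : Type :=
  {l : List (Σ k, (F k).ι) // l.IsChain (fun p q => p.1 ≠ q.1)}

/-- Reduced words which do not begin with a letter of the `k`-th algebra. -/
def Tail (F : ℕ → VNState) (k : ℕ) : Type :=
  {w : Word F // ∀ p ∈ w.1.head?, p.1 ≠ k}

/-- The free product Hilbert space
`ℂ Ω ⊕ ⨁_{m ≥ 1} ⨁_{k₁ ≠ ⋯ ≠ k_m} H°_{k₁} ⊗ ⋯ ⊗ H°_{k_m}`, whose orthonormal basis is formed by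
the reduced words. -/
abbrev Fock (F : ℕ → VNState) : Type := lp (fun _ : Word F => ℂ) 2

variable {F : ℕ → VNState}

/-- The empty word. -/
def emptyWord : Word F := ⟨[], List.IsChain.nil⟩

/-- Put a basis vector of `H k` in front of a word not beginning in the `k`-th algebra; the unit
vector (`none`) is absorbed. -/
def prepend (k : ℕ) : Option (F k).ι × Tail F k → Word F
  | (none, v) => v.1
  | (some i, v) => ⟨⟨k, i⟩ :: v.1.1, List.isChain_cons.2
      ⟨fun p hp => (v.2 p hp).symm, v.1.2⟩⟩

theorem prepend_bijective (k : ℕ) : Function.Bijective (prepend (F := F) k) := by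
  constructor
  · rintro ⟨o, ⟨⟨l, hl⟩, hv⟩⟩ ⟨o', ⟨⟨l', hl'⟩, hv'⟩⟩ h
    have h1 := congrArg Subtype.val h
    cases o with
    | none =>
      cases o' with
      | none =>
        simp only [prepend] at h1
        subst h1
        rfl
      | some i' =>
        simp only [prepend] at h1
        subst h1
        exact absurd rfl (hv ⟨k, i'⟩ (by simp))
    | some i =>
      cases o' with
      | none =>
        simp only [prepend] at h1
        subst h1
        exact absurd rfl (hv' ⟨k, i⟩ (by simp))
      | some i' =>
        simp only [prepend, List.cons.injEq, Sigma.mk.injEq, heq_eq_eq, true_and] at h1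
        obtain ⟨rfl, rfl⟩ := h1
        rfl
  · rintro ⟨l, hl⟩
    cases l with
    | nil => exact ⟨(none, ⟨⟨[], hl⟩, by simp⟩), rfl⟩
    | cons p l =>
      obtain ⟨j, i⟩ := p
      by_cases hj : j = k
      · subst hj
        have h2 := List.isChain_cons.1 hl
        exact ⟨(some i, ⟨⟨l, h2.2⟩, fun p hp => (h2.1 p hp).symm⟩), rfl⟩
      · exact ⟨(none, ⟨⟨⟨j, i⟩ :: l, hl⟩, by simpa using hj⟩), rfl⟩

/-- The decomposition `Fock = H k ⊗ ℓ²(Tail k)` on the level of basis vectors. -/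
def split (k : ℕ) : Option (F k).ι × Tail F k ≃ Word F :=
  Equiv.ofBijective _ (prepend_bijective k)

theorem summable_sq (x : Fock F) : Summable fun w => ‖x w‖ ^ 2 := by
  simpa using (lp.memℓp x).summable (by norm_num)

theorem memlp_of_summable {α : Type*} {f : α → ℂ} (h : Summable fun i => ‖f i‖ ^ 2) :
    Memℓp f 2 := memℓp_gen (by simpa using h)

theorem norm_sq_eq {α : Type*} (x : lp (fun _ : α => ℂ) 2) : ‖x‖ ^ 2 = ∑' i, ‖x i‖ ^ 2 := by
  simpa using lp.norm_rpow_eq_tsum (p := 2) (by norm_num) x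

/-- The component of `x ∈ H k ⊗ ℓ²(Tail k)` at the basis vector `v` of the second factor. -/
def component (k : ℕ) (v : Tail F k) (x : Fock F) : (F k).H :=
  (F k).basis.repr.symm ⟨fun o => x (prepend k (o, v)), memlp_of_summable
    ((summable_sq x).comp_injective
      (i := fun o => prepend k (o, v))
      (fun _ _ h => (Prod.mk.inj ((prepend_bijective k).1 h)).1))⟩

theorem component_add (k : ℕ) (v : Tail F k) (x y : Fock F) :
    component k v (x + y) = component k v x + component k v y := by
  unfold component
  rw [← map_add]
  rfl

theorem component_smul (k : ℕ) (v : Tail F k) (c : ℂ) (x : Fock F) :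
    component k v (c • x) = c • component k v x := by
  unfold component
  rw [← map_smul]
  rfl

theorem norm_component_sq (k : ℕ) (v : Tail F k) (x : Fock F) :
    ‖component k v x‖ ^ 2 = ∑' o, ‖x (prepend k (o, v))‖ ^ 2 := by
  unfold component
  rw [LinearIsometryEquiv.norm_map, norm_sq_eq]

/-- The coefficients of `(a ⊗ 1) x`. -/
def actCoeff (k : ℕ) (a : (F k).H →L[ℂ] (F k).H) (x : Fock F) (w : Word F) : ℂ :=
  (F k).basis.repr (a (component k ((split k).symm w).2 x)) ((split k).symm w).1

theorem summable_prod_sq {V O : Type} (g : V → lp (fun _ : O => ℂ) 2)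
    (hg : Summable fun v => ‖g v‖ ^ 2) :
    (Summable fun p : V × O => ‖g p.1 p.2‖ ^ 2) ∧
      ∑' p : V × O, ‖g p.1 p.2‖ ^ 2 = ∑' v, ‖g v‖ ^ 2 := by
  have hin : ∀ v, Summable fun o => ‖g v o‖ ^ 2 := fun v => by
    simpa using (lp.memℓp (g v)).summable (by norm_num)
  have hS : Summable fun p : V × O => ‖g p.1 p.2‖ ^ 2 :=
    (summable_prod_of_nonneg (fun p => by positivity)).2
      ⟨hin, hg.congr fun v => norm_sq_eq (g v)⟩
  exact ⟨hS, by rw [hS.tsum_prod]; exact tsum_congr fun v => (norm_sq_eq (g v)).symm⟩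

theorem hasSum_component (k : ℕ) (x : Fock F) :
    HasSum (fun v : Tail F k => ‖component k v x‖ ^ 2) (‖x‖ ^ 2) := by
  have hx : Summable fun p : Tail F k × Option (F k).ι => ‖x (prepend k (p.2, p.1))‖ ^ 2 :=
    (summable_sq x).comp_injective
      (((Equiv.prodComm _ _).trans (split k)).injective)
  have hxs := (summable_prod_of_nonneg (fun p => by positivity)).1 hx
  have e1 : ∑' p : Tail F k × Option (F k).ι, ‖x (prepend k (p.2, p.1))‖ ^ 2 =
      ∑' w, ‖x w‖ ^ 2 :=
    ((Equiv.prodComm _ _).trans (split k)).tsum_eq (fun w => ‖x w‖ ^ 2)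
  have h2 : ∑' v : Tail F k, ‖component k v x‖ ^ 2 = ‖x‖ ^ 2 := by
    rw [norm_sq_eq x, ← e1, hx.tsum_prod]
    exact tsum_congr fun v => norm_component_sq k v x
  rw [← h2]
  have h3 : Summable fun v : Tail F k => ‖component k v x‖ ^ 2 := by
    simp only [norm_component_sq]
    exact hxs.2
  exact h3.hasSum

theorem hasSum_actCoeff (k : ℕ) (a : (F k).H →L[ℂ] (F k).H) (x : Fock F) :
    (Summable fun w => ‖actCoeff k a x w‖ ^ 2) ∧
      ∑' w, ‖actCoeff k a x w‖ ^ 2 ≤ (‖a‖ * ‖x‖) ^ 2 := by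
  let g : Tail F k → lp (fun _ : Option (F k).ι => ℂ) 2 :=
    fun v => (F k).basis.repr (a (component k v x))
  have hc := hasSum_component k x
  have hle : ∀ v : Tail F k, ‖g v‖ ^ 2 ≤ ‖a‖ ^ 2 * ‖component k v x‖ ^ 2 := by
    intro v
    have h1 : ‖g v‖ = ‖a (component k v x)‖ := LinearIsometryEquiv.norm_map _ _
    rw [h1, ← mul_pow]
    exact pow_le_pow_left₀ (norm_nonneg _) (a.le_opNorm _) 2
  have hg : Summable fun v => ‖g v‖ ^ 2 :=
    Summable.of_nonneg_of_le (fun v => by positivity) hle (hc.summable.mul_left _)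
  obtain ⟨hS, hT⟩ := summable_prod_sq g hg
  let e : Word F ≃ Tail F k × Option (F k).ι := (split k).symm.trans (Equiv.prodComm _ _)
  have he : ∀ w, actCoeff k a x w = g (e w).1 (e w).2 := fun w => rfl
  simp only [he]
  refine ⟨hS.comp_injective e.injective, ?_⟩
  rw [e.tsum_eq (fun p => ‖g p.1 p.2‖ ^ 2), hT, mul_pow, ← hc.tsum_eq, ← tsum_mul_left]
  exact hg.tsum_le_tsum hle (hc.summable.mul_left _)

/-- The left representation of operators on `H k` on the free product Hilbert space: `a` acts as
`a ⊗ 1` in the decomposition `Fock = H k ⊗ ℓ²(Tail k)`. In particular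
`a (Ω) = (a vac)` and, for mean-zero `a`, `a (e_{i₁} ⊗ ⋯) = (a vac) ⊗ e_{i₁} ⊗ ⋯` if `k₁ ≠ k`. -/
def leftRep (k : ℕ) (a : (F k).H →L[ℂ] (F k).H) : Fock F →L[ℂ] Fock F :=
  LinearMap.mkContinuous
    { toFun := fun x => ⟨actCoeff k a x, memlp_of_summable (hasSum_actCoeff k a x).1⟩
      map_add' := fun x y => by
        ext w
        change actCoeff k a (x + y) w = actCoeff k a x w + actCoeff k a y w
        simp [actCoeff, component_add]
      map_smul' := fun c x => by
        ext w
        change actCoeff k a (c • x) w = c • actCoeff k a x w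
        simp [actCoeff, component_smul] }
    ‖a‖ fun x => by
      refine le_of_sq_le_sq ?_ (by positivity)
      rw [norm_sq_eq]
      exact (hasSum_actCoeff k a x).2

theorem leftRep_apply (k : ℕ) (a : (F k).H →L[ℂ] (F k).H) (x : Fock F)
    (o : Option (F k).ι) (v : Tail F k) :
    leftRep k a x (prepend k (o, v)) = (F k).basis.repr (a (component k v x)) o := by
  change actCoeff k a x (split k (o, v)) = _
  simp [actCoeff]

/-- The von Neumann algebra generated by a set of operators: the double commutant of the
star-closure of the set. -/
def vnGenerated {H : Type*} [NormedAddCommGroup H] [InnerProductSpace ℂ H] [CompleteSpace H]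
    (S : Set (H →L[ℂ] H)) : VonNeumannAlgebra H where
  toStarSubalgebra :=
    StarSubalgebra.centralizer ℂ (StarSubalgebra.centralizer ℂ S : Set (H →L[ℂ] H))
  centralizer_centralizer' := by
    change Set.centralizer (Set.centralizer (SetLike.coe (StarSubalgebra.centralizer ℂ
      (StarSubalgebra.centralizer ℂ S : Set (H →L[ℂ] H))))) = SetLike.coe
        (StarSubalgebra.centralizer ℂ (StarSubalgebra.centralizer ℂ S : Set (H →L[ℂ] H)))
    rw [StarSubalgebra.coe_centralizer_centralizer]
    simp

/-- The reduced free product von Neumann algebra of the whole family. -/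
def algebra (F : ℕ → VNState) : VonNeumannAlgebra (Fock F) :=
  vnGenerated (⋃ k : ℕ, leftRep k '' ((F k).alg : Set ((F k).H →L[ℂ] (F k).H)))

/-- The natural filtration: the von Neumann subalgebra `A₀ * A₁ * ⋯ * Aₙ`. -/
def filtration (F : ℕ → VNState) (n : ℕ) : VonNeumannAlgebra (Fock F) :=
  vnGenerated (⋃ k ≤ n, leftRep k '' ((F k).alg : Set ((F k).H →L[ℂ] (F k).H)))

/-- The vacuum vector `Ω`; the free product state is `φ(x) = ⟪Ω, x Ω⟫`. -/
def Ω (F : ℕ → VNState) : Fock F := by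
  classical exact lp.single 2 emptyWord (1 : ℂ)

/-- The subspace `L₂(N)`, the closure of `N Ω`. -/
def L2 (N : VonNeumannAlgebra (Fock F)) : Submodule ℂ (Fock F) :=
  (Submodule.span ℂ {v | ∃ a ∈ N, v = a (Ω F)}).topologicalClosure

instance (N : VonNeumannAlgebra (Fock F)) : CompleteSpace (L2 N) :=
  (Submodule.isClosed_topologicalClosure _).completeSpace_coe

/-- `y` is the state-preserving conditional expectation `E_N(x) = Q x Q` of `x` on `N`, where `Q`
is the orthogonal projection onto `L₂(N)` and an element `y` of `N` is identified with its
restriction `Q y Q` to `L₂(N)`. -/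
def IsCondExp (N : VonNeumannAlgebra (Fock F)) (x y : Fock F →L[ℂ] Fock F) : Prop :=
  y ∈ N ∧ (L2 N).starProjection * y * (L2 N).starProjection =
    (L2 N).starProjection * x * (L2 N).starProjection

/-- Free martingales in `L_∞(A)`, `A = A₀ * A₁ * ⋯`: sequences adapted to the natural filtration
with `Eₙ(x_m) = xₙ` for `n ≤ m`. -/
def IsFreeMartingale (F : ℕ → VNState) (x : ℕ → (Fock F →L[ℂ] Fock F)) : Prop :=
  (∀ n, x n ∈ filtration F n) ∧ ∀ n m, n ≤ m → IsCondExp (filtration F n) (x m) (x n)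

section SquareFunctions

variable {H : Type*} [NormedAddCommGroup H] [InnerProductSpace ℂ H] [CompleteSpace H]

/-- Martingale differences; the first one is the first term of the martingale. -/
def diff (x : ℕ → (H →L[ℂ] H)) : ℕ → (H →L[ℂ] H)
  | 0 => x 0
  | k + 1 => x (k + 1) - x k

/-- The row square function `(∑ dx_k dx_k^*)^{1/2}` of the first `N` differences. -/
def rowSquare (x : ℕ → (H →L[ℂ] H)) (N : ℕ) : H →L[ℂ] H :=
  CFC.sqrt (∑ k ∈ Finset.range N, diff x k * star (diff x k))

/-- The column square function `(∑ dx_k^* dx_k)^{1/2}` of the first `N` differences. -/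
def colSquare (x : ℕ → (H →L[ℂ] H)) (N : ℕ) : H →L[ℂ] H :=
  CFC.sqrt (∑ k ∈ Finset.range N, star (diff x k) * diff x k)

end SquareFunctions

/-- The lower Burkholder–Gundy estimate in `L_∞(A)` for the first `2n` differences holds with
constant `K` for all free martingales in the free product of the family `F`. -/
def LowerEstimate (F : ℕ → VNState) (n : ℕ) (K : ℝ≥0) : Prop :=
  ∀ x : ℕ → (Fock F →L[ℂ] Fock F), IsFreeMartingale F x →
    max ‖rowSquare x (2 * n)‖ ‖colSquare x (2 * n)‖ ≤
      K * ‖∑ k ∈ Finset.range (2 * n), diff x k‖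

/-- The best constant in the lower estimate within the free product of the family `F`
(`∞` if there is none). -/
def bestConstantOf (F : ℕ → VNState) (n : ℕ) : ℝ≥0∞ :=
  ⨅ (K : ℝ≥0) (_ : LowerEstimate F n K), (K : ℝ≥0∞)

/-- The best constant in the lower estimate valid for all free martingales in all reduced free
products (`∞` if there is none). -/
def bestConstant (n : ℕ) : ℝ≥0∞ :=
  ⨅ (K : ℝ≥0) (_ : ∀ F : ℕ → VNState, LowerEstimate F n K), (K : ℝ≥0∞)

end FreeProd

end

/-! The obstruction is the unboundedness of triangular truncation on matrices. The Hilbert matrix `1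
/ (p - q)` is bounded on `ℓ²` uniformly in its size (`HilbertInequality.sum_norm_sq_le`), while its
lower triangle has row sums `harmonic k ~ log k`. It therefore suffices to realise this matrix in a
free product so that the filtration cuts it by `max p q`.

Let `u_p` be the mean-zero symmetry generating an algebra of even index, and let `a_N` be the
generator `[[0, r], [r, 1]]` of an odd one. As `r → 0`, `a_N` tends to the projection onto words
beginning with `N`. In that limit `u_p a_N u_q` sends the word `q N v` to `p N v` and kills all
words not beginning with `q N`, so these products are matrix units and `∑ u_p a_N u_q / (p - q)` has
norm at most `π` (`norm_hilbertSum_proj_le`). Faithfulness of the state forces `r ≠ 0`, but `r =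
N⁻²` with `N = 2m + 1` makes the total error of the `m²` terms at most one
(`norm_hilbertMartingale_le`).

With `N` below all outer indices, the conditional expectation keeps exactly the terms with both
outer indices in range (`isFreeMartingale_hilbertMartingale`). The difference at the index of `u_k`
thus contains the part of row `k` with `q ≤ k`. Evaluated on the sum of the `m` basis vectors `q N`,
it has the coordinate `harmonic k` at the word `k N`. The column square function alone then gives `∑
(harmonic k)² ≤ (K (π + 1))² m` (`sum_harmonic_sq_le`), hence `K ≳ log m`. One fixed family serves
all `m`, because each `m` has its own odd index. -/

noncomputable section

/-! ### Hilbert's inequality for the matrix `1 / (i - j)`. -/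

namespace HilbertInequality

open Complex Finset

/-- The exponential `e^{2πi n t}`. -/
def expo (n : ℤ) (t : ℝ) : ℂ := exp (2 * Real.pi * I * n * t)

theorem continuous_expo (n : ℤ) : Continuous (expo n) := by
  unfold expo; fun_prop

theorem expo_add (m n : ℤ) (t : ℝ) : expo (m + n) t = expo m t * expo n t := by
  unfold expo; rw [← exp_add]; push_cast; ring_nf

theorem conj_expo (n : ℤ) (t : ℝ) : (starRingEnd ℂ) (expo n t) = expo (-n) t := by
  unfold expo; rw [← exp_conj]; simp [conj_ofNat]

theorem integral_expo (n : ℤ) : ∫ t in (0 : ℝ)..1, expo n t = if n = 0 then 1 else 0 := by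
  split_ifs with h
  · subst h; simp [expo]
  · have hc : (2 * Real.pi * I * n : ℂ) ≠ 0 := by
      simp [Real.pi_ne_zero, h]
    unfold expo
    rw [integral_exp_mul_complex hc]
    have : exp (2 * Real.pi * I * n * (1 : ℝ)) = 1 := by
      rw [← exp_int_mul_two_pi_mul_I n]; push_cast; ring_nf
    rw [this]; simp

/-- The Hilbert kernel is, up to the factor `-2πi`, the Fourier transform of a bounded sawtooth. The
case `n = 0` is included: the sawtooth has mean zero and `0⁻¹ = 0`. -/
theorem integral_bernoulli_mul_expo (n : ℤ) :
    ∫ t in (0 : ℝ)..1, expo (-n) t * ((t - 1 / 2 : ℝ) : ℂ) = -(2 * Real.pi * I * n)⁻¹ := by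
  have h := bernoulliFourierCoeff_eq one_ne_zero n
  rw [bernoulliFourierCoeff, fourierCoeffOn_eq_integral] at h
  simp only [sub_zero, div_one, one_smul, bernoulliFun_one, fourier_coe_apply, smul_eq_mul,
    Nat.factorial_one, Nat.cast_one, pow_one] at h
  rw [neg_div, one_div (2 * Real.pi * I * n : ℂ)] at h
  rw [← h]
  refine intervalIntegral.integral_congr fun t _ => ?_
  simp [expo]

/-- The trigonometric polynomial with coefficients `y j`, `j ∈ s`. -/
def trigPoly (s : Finset ℕ) (y : ℕ → ℂ) (t : ℝ) : ℂ := ∑ j ∈ s, y j * expo j t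

theorem continuous_trigPoly (s : Finset ℕ) (y : ℕ → ℂ) : Continuous (trigPoly s y) :=
  continuous_finsetSum _ fun _ _ => continuous_const.mul (continuous_expo _)

theorem integral_norm_sq_trigPoly (s : Finset ℕ) (y : ℕ → ℂ) :
    ∫ t in (0 : ℝ)..1, ‖trigPoly s y t‖ ^ 2 = ∑ j ∈ s, ‖y j‖ ^ 2 := by
  have key : ∫ t in (0 : ℝ)..1, ((‖trigPoly s y t‖ ^ 2 : ℝ) : ℂ) =
      ∑ i ∈ s, ∑ j ∈ s, y i * (starRingEnd ℂ) (y j) * if i = j then 1 else 0 := by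
    have e : ∀ t : ℝ, ((‖trigPoly s y t‖ ^ 2 : ℝ) : ℂ) =
        ∑ i ∈ s, ∑ j ∈ s, y i * (starRingEnd ℂ) (y j) * expo (i - j) t := by
      intro t
      rw [ofReal_pow, ← mul_conj', trigPoly, map_sum, sum_mul_sum]
      refine sum_congr rfl fun i _ => sum_congr rfl fun j _ => ?_
      rw [map_mul, conj_expo, sub_eq_add_neg, expo_add]
      ring
    simp only [e]
    have hc : ∀ i j : ℕ, Continuous fun t : ℝ =>
        y i * (starRingEnd ℂ) (y j) * expo (i - j) t :=
      fun i j => continuous_const.mul (continuous_expo _)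
    rw [intervalIntegral.integral_finsetSum fun i _ =>
      (continuous_finsetSum _ fun j _ => hc i j).intervalIntegrable _ _]
    refine sum_congr rfl fun i _ => ?_
    rw [intervalIntegral.integral_finsetSum fun j _ => (hc i j).intervalIntegrable _ _]
    refine sum_congr rfl fun j _ => ?_
    rw [intervalIntegral.integral_const_mul, integral_expo]
    simp [sub_eq_zero]
  have := key
  rw [intervalIntegral.integral_ofReal] at this
  apply ofReal_injective
  rw [this]
  push_cast
  refine sum_congr rfl fun i hi => ?_
  simp [hi, mul_conj']

/-- The kernel `1 / (i - j)`, which vanishes on the diagonal. -/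
def kernel (i j : ℕ) : ℂ := ((i : ℂ) - j)⁻¹

/-- The form is `-2πi` times the integral of two trigonometric polynomials against the sawtooth,
which is at most `1/2` in modulus; the arithmetic-geometric mean inequality and Parseval do the
rest. -/
theorem norm_bilinear_le (s : Finset ℕ) (x y : ℕ → ℂ) :
    ‖∑ i ∈ s, ∑ j ∈ s, (starRingEnd ℂ) (x i) * kernel i j * y j‖ ≤
      Real.pi / 2 * (∑ i ∈ s, ‖x i‖ ^ 2 + ∑ j ∈ s, ‖y j‖ ^ 2) := by
  have e : ∑ i ∈ s, ∑ j ∈ s, (starRingEnd ℂ) (x i) * kernel i j * y j =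
      (-(2 * Real.pi * I)) * ∫ t in (0 : ℝ)..1,
        (starRingEnd ℂ) (trigPoly s x t) * trigPoly s y t * ((t - 1 / 2 : ℝ) : ℂ) := by
    have e1 : ∀ t : ℝ, (starRingEnd ℂ) (trigPoly s x t) * trigPoly s y t * ((t - 1 / 2 : ℝ) : ℂ) =
        ∑ i ∈ s, ∑ j ∈ s, (starRingEnd ℂ) (x i) * y j *
          (expo (-((i : ℤ) - j)) t * ((t - 1 / 2 : ℝ) : ℂ)) := by
      intro t
      rw [trigPoly, trigPoly, map_sum, sum_mul_sum, sum_mul]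
      refine sum_congr rfl fun i _ => ?_
      rw [sum_mul]
      refine sum_congr rfl fun j _ => ?_
      rw [map_mul, conj_expo, neg_sub, sub_eq_add_neg (j : ℤ), expo_add]
      ring
    simp only [e1]
    have hc : ∀ i j : ℕ, Continuous fun t : ℝ => (starRingEnd ℂ) (x i) * y j *
          (expo (-((i : ℤ) - j)) t * ((t - 1 / 2 : ℝ) : ℂ)) :=
      fun i j => continuous_const.mul ((continuous_expo _).mul (by fun_prop))
    rw [intervalIntegral.integral_finsetSum fun i _ =>
      (continuous_finsetSum _ fun j _ => hc i j).intervalIntegrable _ _, mul_sum]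
    refine sum_congr rfl fun i _ => ?_
    rw [intervalIntegral.integral_finsetSum fun j _ => (hc i j).intervalIntegrable _ _, mul_sum]
    refine sum_congr rfl fun j _ => ?_
    rw [intervalIntegral.integral_const_mul, integral_bernoulli_mul_expo, kernel, mul_inv]
    have : (2 * Real.pi * I : ℂ) ≠ 0 := by simp [Real.pi_ne_zero]
    push_cast
    field_simp
  have hx := integral_norm_sq_trigPoly s x
  have hy := integral_norm_sq_trigPoly s y
  have cx : Continuous fun t => ‖trigPoly s x t‖ ^ 2 := (continuous_trigPoly s x).norm.pow 2
  have cy : Continuous fun t => ‖trigPoly s y t‖ ^ 2 := (continuous_trigPoly s y).norm.pow 2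
  have hle : ‖∫ t in (0 : ℝ)..1,
        (starRingEnd ℂ) (trigPoly s x t) * trigPoly s y t * ((t - 1 / 2 : ℝ) : ℂ)‖ ≤
      ∫ t in (0 : ℝ)..1, 1 / 4 * (‖trigPoly s x t‖ ^ 2 + ‖trigPoly s y t‖ ^ 2) := by
    refine intervalIntegral.norm_integral_le_of_norm_le zero_le_one
      (Filter.Eventually.of_forall fun t ht => ?_)
      ((continuous_const.mul (cx.add cy)).intervalIntegrable _ _)
    rw [norm_mul, norm_mul, RCLike.norm_conj, norm_real, Real.norm_eq_abs]
    have h1 : |t - 1 / 2| ≤ 1 / 2 := abs_le.2 ⟨by linarith [ht.1], by linarith [ht.2]⟩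
    have h2 : 0 ≤ ‖trigPoly s x t‖ * ‖trigPoly s y t‖ := by positivity
    nlinarith [sq_nonneg (‖trigPoly s x t‖ - ‖trigPoly s y t‖), mul_le_mul_of_nonneg_left h1 h2]
  rw [intervalIntegral.integral_const_mul, intervalIntegral.integral_add
    (cx.intervalIntegrable _ _) (cy.intervalIntegrable _ _), hx, hy] at hle
  rw [e, norm_mul, norm_neg]
  have hn : ‖(2 * Real.pi * I : ℂ)‖ = 2 * Real.pi := by
    simp [abs_of_pos Real.pi_pos]
  rw [hn]
  nlinarith [mul_le_mul_of_nonneg_left hle (by positivity : 0 ≤ 2 * Real.pi)]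

/-- **Hilbert's inequality**: the matrix `1 / (i - j)` has norm at most `π` on `ℓ²`. -/
theorem sum_norm_sq_le (s : Finset ℕ) (y : ℕ → ℂ) :
    ∑ i ∈ s, ‖∑ j ∈ s, kernel i j * y j‖ ^ 2 ≤ Real.pi ^ 2 * ∑ j ∈ s, ‖y j‖ ^ 2 := by
  set z : ℕ → ℂ := fun i => ∑ j ∈ s, kernel i j * y j with hz
  -- Duality with the test sequence `z / π`: this scaling balances the two sides so that half of the
  -- `z` term can be absorbed, leaving the constant `π`.
  have h := norm_bilinear_le s (fun i => ((Real.pi⁻¹ : ℝ) : ℂ) * z i) y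
  have e : ∑ i ∈ s, ∑ j ∈ s, (starRingEnd ℂ) (((Real.pi⁻¹ : ℝ) : ℂ) * z i) * kernel i j * y j =
      ((Real.pi⁻¹ * ∑ i ∈ s, ‖z i‖ ^ 2 : ℝ) : ℂ) := by
    rw [ofReal_mul, ofReal_sum, mul_sum]
    refine sum_congr rfl fun i _ => ?_
    simp only [mul_assoc]
    rw [← mul_sum, map_mul, conj_ofReal, ofReal_pow, ← conj_mul' (z i), mul_assoc]
  rw [e, norm_real, Real.norm_of_nonneg (by positivity)] at h
  simp only [norm_mul, mul_pow, norm_real, Real.norm_eq_abs, sq_abs] at h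
  rw [← mul_sum] at h
  have hpi := Real.pi_pos
  set A := ∑ i ∈ s, ‖z i‖ ^ 2
  set B := ∑ j ∈ s, ‖y j‖ ^ 2
  have h' := mul_le_mul_of_nonneg_left h (by positivity : 0 ≤ 2 * Real.pi)
  have e1 : 2 * Real.pi * (Real.pi⁻¹ * A) = 2 * A := by field_simp
  have e2 : 2 * Real.pi * (Real.pi / 2 * (Real.pi⁻¹ ^ 2 * A + B)) = A + Real.pi ^ 2 * B := by
    field_simp
  linarith

end HilbertInequality

namespace FreeProd

/-! ### Two-point algebras and the family built from them. -/

/-- The operator with matrix `[[0, r], [r, d]]` on `ℂ²`. -/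
def twoPointOp (r d : ℝ) :
    EuclideanSpace ℂ (Option Unit) →L[ℂ] EuclideanSpace ℂ (Option Unit) :=
  Matrix.toEuclideanCLM (𝕜 := ℂ) (Matrix.of fun i j =>
    match i, j with
    | none, none => 0
    | some _, some _ => (d : ℂ)
    | _, _ => (r : ℂ))

theorem twoPointOp_none (r d : ℝ) (x : EuclideanSpace ℂ (Option Unit)) :
    twoPointOp r d x none = r * x (some ()) := by
  simp [twoPointOp, Matrix.ofLp_toEuclideanCLM, Matrix.mulVec, dotProduct, Fintype.sum_option]

theorem twoPointOp_some (r d : ℝ) (x : EuclideanSpace ℂ (Option Unit)) :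
    twoPointOp r d x (some ()) = r * x none + d * x (some ()) := by
  simp [twoPointOp, Matrix.ofLp_toEuclideanCLM, Matrix.mulVec, dotProduct, Fintype.sum_option]

theorem star_twoPointOp (r d : ℝ) : star (twoPointOp r d) = twoPointOp r d := by
  rw [twoPointOp, ← map_star]
  congr 1
  ext i j
  rcases i with _ | i <;> rcases j with _ | j <;> simp [Matrix.star_apply]

theorem twoPointOp_ext {x y : EuclideanSpace ℂ (Option Unit)} (h0 : x none = y none)
    (h1 : x (some ()) = y (some ())) : x = y := by
  ext i
  rcases i with _ | i
  · exact h0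
  · exact h1

theorem norm_twoPointOp_le (r : ℝ) : ‖twoPointOp r 0‖ ≤ |r| := by
  refine ContinuousLinearMap.opNorm_le_bound _ (abs_nonneg _) fun x => ?_
  refine le_of_sq_le_sq ?_ (by positivity)
  rw [mul_pow, EuclideanSpace.norm_sq_eq, EuclideanSpace.norm_sq_eq]
  simp only [Fintype.sum_option, twoPointOp_none, Finset.univ_unique, Finset.sum_singleton,
    PUnit.default_eq_unit, twoPointOp_some]
  simp [mul_pow]
  linarith

theorem mem_vnGenerated {H : Type*} [NormedAddCommGroup H] [InnerProductSpace ℂ H]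
    [CompleteSpace H] {S : Set (H →L[ℂ] H)} {a : H →L[ℂ] H} (ha : a ∈ S) : a ∈ vnGenerated S := by
  change a ∈ StarSubalgebra.centralizer ℂ (StarSubalgebra.centralizer ℂ S : Set (H →L[ℂ] H))
  rw [StarSubalgebra.mem_centralizer_iff]
  intro g hg
  have hg' := (StarSubalgebra.mem_centralizer_iff ℂ).1 hg
  have hs := (StarSubalgebra.mem_centralizer_iff ℂ).1 (star_mem hg)
  exact ⟨((hg' a ha).1).symm, ((hs a ha).1).symm⟩

theorem commute_of_mem_vnGenerated {H : Type*} [NormedAddCommGroup H] [InnerProductSpace ℂ H]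
    [CompleteSpace H] {S : Set (H →L[ℂ] H)} {a p : H →L[ℂ] H} (ha : a ∈ vnGenerated S)
    (hp : ∀ g ∈ S, g * p = p * g) (hps : ∀ g ∈ S, star g * p = p * star g) : p * a = a * p := by
  have ha' : a ∈ StarSubalgebra.centralizer ℂ
    (StarSubalgebra.centralizer ℂ S : Set (H →L[ℂ] H)) := ha
  rw [StarSubalgebra.mem_centralizer_iff] at ha'
  exact (ha' p ((StarSubalgebra.mem_centralizer_iff ℂ).2 fun g hg => ⟨hp g hg, hps g hg⟩)).1

theorem smul_mem_vonNeumannAlgebra {H : Type*} [NormedAddCommGroup H] [InnerProductSpace ℂ H]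
    [CompleteSpace H] (N : VonNeumannAlgebra H) (c : ℂ) {a : H →L[ℂ] H} (ha : a ∈ N) : c • a ∈ N :=
  N.toStarSubalgebra.smul_mem ha c

/-- The algebra `ℂ²` with a faithful state in its GNS representation, generated by a mean-zero
self-adjoint element with matrix `[[0, r], [r, d]]`. -/
abbrev twoPoint (r d : ℝ) (hr : r ≠ 0) : VNState where
  H := EuclideanSpace ℂ (Option Unit)
  alg := vnGenerated {twoPointOp r d}
  ι := Unit
  basis := (EuclideanSpace.basisFun (Option Unit) ℂ).toHilbertBasis
  cyclic := by
    have hr' : (r : ℂ) ≠ 0 := by exact_mod_cast hr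
    refine Dense.mono (s₁ := Set.univ) (fun x _ => ?_) dense_univ
    -- Since `r ≠ 0`, the vacuum and its image under the generator span `ℂ²`.
    refine ⟨x none • 1 + (x (some ()) / r) • twoPointOp r d,
      add_mem (smul_mem_vonNeumannAlgebra _ _ (one_mem _))
        (smul_mem_vonNeumannAlgebra _ _ (mem_vnGenerated rfl)), ?_⟩
    refine twoPointOp_ext ?_ ?_
    · simp [twoPointOp_none]
    · simp [twoPointOp_some, hr']
  separating := by
    have hr' : (r : ℂ) ≠ 0 := by exact_mod_cast hr
    intro a ha h0
    -- The algebra is commutative, so an element killing the vacuum also kills the generator applied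
    -- to the vacuum, hence all of `ℂ²`.
    have hc := commute_of_mem_vnGenerated (p := twoPointOp r d) ha (by simp)
      (by simp [star_twoPointOp])
    simp only [OrthonormalBasis.coe_toHilbertBasis, EuclideanSpace.basisFun_apply] at h0
    have h1 : a (twoPointOp r d (EuclideanSpace.single none 1)) = 0 := by
      have := congrArg (fun T => T (EuclideanSpace.single none (1 : ℂ))) hc
      simp only [mul_apply_eq_comp] at this
      rw [← this, h0, map_zero]
    ext1 x
    have hx : x = x none • EuclideanSpace.single none (1 : ℂ) +
        (x (some ()) / r) • twoPointOp r d (EuclideanSpace.single none (1 : ℂ)) := by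
      refine twoPointOp_ext ?_ ?_
      · simp [twoPointOp_none]
      · simp [twoPointOp_some, hr']
    rw [hx, map_add, map_smul, map_smul, h0, h1]
    simp

theorem repr_twoPoint (r d : ℝ) (hr : r ≠ 0) (x : (twoPoint r d hr).H) (o : Option Unit) :
    (twoPoint r d hr).basis.repr x o = (x : EuclideanSpace ℂ (Option Unit)) o := by
  rw [HilbertBasis.repr_apply_apply]
  simp [EuclideanSpace.inner_single_left]

/-- Diagonal entry of the generator of the `k`-th algebra. -/
def diagEntry (k : ℕ) : ℝ := if Even k then 0 else 1

/-- Off-diagonal entry of the generator of the `k`-th algebra. -/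
def offEntry (k : ℕ) : ℝ := if Even k then 1 else ((k : ℝ) ^ 2)⁻¹

theorem offEntry_ne_zero (k : ℕ) : offEntry k ≠ 0 := by
  unfold offEntry
  split_ifs with h
  · exact one_ne_zero
  · have : k ≠ 0 := by rintro rfl; simp at h
    positivity

/-- The family of two-point algebras; those of odd index are generated by an element which is small
in `L₂` and has operator norm at least one. -/
abbrev family (k : ℕ) : VNState := twoPoint (offEntry k) (diagEntry k) (offEntry_ne_zero k)

/-- The action of `[[0, r], [r, d]]` on the `k`-th tensor leg. -/
def leg (k : ℕ) (r d : ℝ) : Fock family →L[ℂ] Fock family := leftRep k (twoPointOp r d)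

/-- Put the letter `k` in front of a word which does not begin with `k`. -/
def cons (k : ℕ) (v : Tail family k) : Word family := prepend k (some (), v)

theorem component_apply (k : ℕ) (v : Tail family k) (x : Fock family) (o : Option Unit) :
    (component k v x : EuclideanSpace ℂ (Option Unit)) o = x (prepend k (o, v)) := by
  rw [← repr_twoPoint (offEntry k) (diagEntry k) (offEntry_ne_zero k)]
  unfold component
  rw [LinearIsometryEquiv.apply_symm_apply]

theorem leg_apply_tail (k : ℕ) (r d : ℝ) (x : Fock family) (v : Tail family k) :
    leg k r d x v.1 = r * x (cons k v) := by
  have h := leftRep_apply (F := family) k (twoPointOp r d) x none v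
  rw [repr_twoPoint, twoPointOp_none, component_apply] at h
  exact h

theorem leg_apply_cons (k : ℕ) (r d : ℝ) (x : Fock family) (v : Tail family k) :
    leg k r d x (cons k v) = r * x v.1 + d * x (cons k v) := by
  have h := leftRep_apply (F := family) k (twoPointOp r d) x (some ()) v
  rw [repr_twoPoint, twoPointOp_some, component_apply, component_apply] at h
  exact h

/-! ### Truncation to sets of words and conditional expectations. -/

section Truncation

variable {F : ℕ → VNState}

theorem norm_coord_sq_sum_le {β : Type*} (x : Fock F) (e : β → Word F)
    (he : Function.Injective e) : Summable (fun b => ‖x (e b)‖ ^ 2) ∧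
      ∑' b, ‖x (e b)‖ ^ 2 ≤ ‖x‖ ^ 2 := by
  refine ⟨(summable_sq x).comp_injective he, ?_⟩
  rw [norm_sq_eq]
  exact tsum_comp_le_tsum_of_inj (summable_sq x) (fun _ => by positivity) he

open Classical in
/-- The orthogonal projection onto the span of a set of words. -/
def trunc (s : Set (Word F)) : Fock F →L[ℂ] Fock F :=
  LinearMap.mkContinuous
    { toFun := fun x => ⟨fun w => if w ∈ s then x w else 0, memlp_of_summable
        ((summable_sq x).of_nonneg_of_le (fun _ => by positivity) fun w => by
          split_ifs <;> simp)⟩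
      map_add' := fun x y => by
        ext w
        change (if w ∈ s then (x + y) w else 0) =
          (if w ∈ s then x w else 0) + (if w ∈ s then y w else 0)
        split_ifs <;> simp
      map_smul' := fun c x => by
        ext w
        change (if w ∈ s then (c • x) w else 0) = c • (if w ∈ s then x w else 0)
        split_ifs <;> simp }
    1 fun x => by
      rw [one_mul]
      refine le_of_sq_le_sq ?_ (by positivity)
      rw [norm_sq_eq, norm_sq_eq]
      refine Summable.tsum_le_tsum (fun w => ?_) (summable_sq _) (summable_sq x)
      change ‖if w ∈ s then x w else 0‖ ^ 2 ≤ _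
      split_ifs <;> simp

open Classical in
theorem trunc_apply (s : Set (Word F)) (x : Fock F) (w : Word F) :
    trunc s x w = if w ∈ s then x w else 0 := rfl

theorem star_trunc (s : Set (Word F)) : star (trunc s) = trunc s := by
  rw [ContinuousLinearMap.star_eq_adjoint]
  symm
  rw [ContinuousLinearMap.eq_adjoint_iff]
  intro x y
  rw [lp.inner_eq_tsum, lp.inner_eq_tsum]
  refine tsum_congr fun w => ?_
  rw [trunc_apply, trunc_apply]
  split_ifs <;> simp

/-- The hypothesis says that `s` is a union of full fibres of `H k ⊗ ℓ²(Tail k)`, so the truncation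
has the form `1 ⊗ P` and commutes with `a ⊗ 1`. -/
theorem leftRep_mul_trunc (k : ℕ) (s : Set (Word F))
    (hs : ∀ (o : Option (F k).ι) (v : Tail F k), prepend k (o, v) ∈ s ↔ v.1 ∈ s)
    (a : (F k).H →L[ℂ] (F k).H) : leftRep k a * trunc s = trunc s * leftRep k a := by
  ext x w
  obtain ⟨⟨o, v⟩, rfl⟩ := (prepend_bijective k).2 w
  have h1 : (leftRep k a * trunc s) x = leftRep k a (trunc s x) := rfl
  have h2 : (trunc s * leftRep k a) x = trunc s (leftRep k a x) := rfl
  rw [h1, h2, trunc_apply, leftRep_apply, leftRep_apply, hs]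
  by_cases hv : v.1 ∈ s
  · have : component k v (trunc s x) = component k v x := by
      unfold component
      congr 1
      ext o
      change trunc s x (prepend k (o, v)) = x (prepend k (o, v))
      rw [trunc_apply, if_pos ((hs o v).2 hv)]
    rw [this, if_pos hv]
  · have : component k v (trunc s x) = 0 := by
      unfold component
      rw [LinearIsometryEquiv.symm_apply_eq, map_zero]
      ext o
      change trunc s x (prepend k (o, v)) = 0
      rw [trunc_apply, if_neg (fun h => hv ((hs o v).1 h))]
    rw [this, if_neg hv]
    simp

theorem leftRep_mem_filtration {k n : ℕ} (hk : k ≤ n) {a : (F k).H →L[ℂ] (F k).H}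
    (ha : a ∈ (F k).alg) : leftRep k a ∈ filtration F n :=
  mem_vnGenerated (Set.mem_iUnion₂.2 ⟨k, hk, a, ha, rfl⟩)

/-- Words all of whose letters have index at most `n`. -/
def lowWords (F : ℕ → VNState) (n : ℕ) : Set (Word F) := {w | ∀ p ∈ w.1, p.1 ≤ n}

theorem prepend_mem_lowWords {k n : ℕ} (hk : k ≤ n) (o : Option (F k).ι) (v : Tail F k) :
    prepend k (o, v) ∈ lowWords F n ↔ v.1 ∈ lowWords F n := by
  cases o with
  | none => rfl
  | some i =>
    change (∀ p ∈ (⟨k, i⟩ :: v.1.1 : List (Σ k, (F k).ι)), p.1 ≤ n) ↔ ∀ p ∈ v.1.1, p.1 ≤ n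
    simp [hk]

theorem trunc_low_commute {n : ℕ} {a : Fock F →L[ℂ] Fock F} (ha : a ∈ filtration F n) :
    trunc (lowWords F n) * a = a * trunc (lowWords F n) := by
  have h : ∀ g ∈ ⋃ k ≤ n, leftRep k '' ((F k).alg : Set ((F k).H →L[ℂ] (F k).H)),
      g * trunc (lowWords F n) = trunc (lowWords F n) * g := by
    intro g hg
    obtain ⟨k, hk, b, hb, rfl⟩ := Set.mem_iUnion₂.1 hg
    exact leftRep_mul_trunc k _ (prepend_mem_lowWords hk) b
  refine commute_of_mem_vnGenerated ha h fun g hg => ?_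
  have := congrArg star (h g hg)
  rw [star_mul, star_mul, star_trunc] at this
  exact this.symm

open Classical in
theorem Ω_apply (w : Word F) : Ω F w = if w = emptyWord then 1 else 0 := by
  simp only [Ω, lp.single_apply, Pi.single_apply]

theorem trunc_low_of_mem_L2 {n : ℕ} {x : Fock F} (hx : x ∈ L2 (filtration F n)) :
    trunc (lowWords F n) x = x := by
  have hV : IsClosed {x : Fock F | trunc (lowWords F n) x = x} :=
    isClosed_eq (trunc (lowWords F n)).continuous continuous_id
  let V : Submodule ℂ (Fock F) :=
    LinearMap.eqLocus (trunc (lowWords F n)).toLinearMap LinearMap.id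
  have hle : L2 (filtration F n) ≤ V := by
    refine Submodule.topologicalClosure_minimal _ (Submodule.span_le.2 ?_) hV
    rintro _ ⟨a, ha, rfl⟩
    have h := congrArg (fun T => T (Ω F)) (trunc_low_commute ha)
    have hΩ : trunc (lowWords F n) (Ω F) = Ω F := by
      ext w
      rw [trunc_apply, Ω_apply]
      by_cases hw : w = emptyWord
      · have : w ∈ lowWords F n := by subst hw; exact fun p hp => absurd hp List.not_mem_nil
        simp [this]
      · simp [hw]
    change trunc (lowWords F n) (a (Ω F)) = a (trunc (lowWords F n) (Ω F)) at h
    rw [hΩ] at h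
    exact h
  exact hle hx

/-- Only the inclusion of `L2 (filtration F n)` in the range of the truncation is needed:
compressing to the larger space first loses nothing. -/
theorem isCondExp_of_trunc {n : ℕ} {x y : Fock F →L[ℂ] Fock F} (hy : y ∈ filtration F n)
    (h : trunc (lowWords F n) * y * trunc (lowWords F n) =
      trunc (lowWords F n) * x * trunc (lowWords F n)) : IsCondExp (filtration F n) x y := by
  refine ⟨hy, ?_⟩
  set Q := (L2 (filtration F n)).starProjection
  set P := trunc (lowWords F n)
  have h1 : P * Q = Q := by
    ext1 z
    exact trunc_low_of_mem_L2 (Submodule.starProjection_apply_mem _ z)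
  have h2 : Q * P = Q := by
    have := congrArg star h1
    rw [star_mul, star_trunc, (isSelfAdjoint_starProjection _).star_eq] at this
    exact this
  have e : ∀ T : Fock F →L[ℂ] Fock F, Q * T * Q = Q * (P * T * P) * Q := fun T => by
    calc Q * T * Q = (Q * P) * T * (P * Q) := by rw [h1, h2]
      _ = _ := by simp only [mul_assoc]
  rw [e y, h, ← e x]

end Truncation

/-! ### Consequences of the lower estimate. -/

/-- The left side equals `‖C ξ‖ ^ 2` for the column square function `C`; the row square function is
not needed. -/
theorem LowerEstimate.sum_le {F : ℕ → VNState} {n : ℕ} {K : ℝ≥0} (h : LowerEstimate F n K)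
    {x : ℕ → (Fock F →L[ℂ] Fock F)} (hx : IsFreeMartingale F x) (ξ : Fock F) :
    ∑ k ∈ Finset.range (2 * n), ‖diff x k ξ‖ ^ 2 ≤
      (K * ‖∑ k ∈ Finset.range (2 * n), diff x k‖ * ‖ξ‖) ^ 2 := by
  have h1 := (le_max_right _ _).trans (h x hx)
  set C := colSquare x (2 * n) with hC
  have hnn : 0 ≤ ∑ k ∈ Finset.range (2 * n), star (diff x k) * diff x k :=
    Finset.sum_nonneg fun k _ => star_mul_self_nonneg _
  have hCC : C * C = ∑ k ∈ Finset.range (2 * n), star (diff x k) * diff x k :=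
    CFC.sqrt_mul_sqrt_self _ hnn
  have hsa : star C = C := (IsSelfAdjoint.of_nonneg (CFC.sqrt_nonneg _)).star_eq
  have h2 : ∑ k ∈ Finset.range (2 * n), ‖diff x k ξ‖ ^ 2 = ‖C ξ‖ ^ 2 := by
    have hn : ∀ T : Fock F →L[ℂ] Fock F,
        ((‖T ξ‖ ^ 2 : ℝ) : ℂ) = inner ℂ ((star T * T) ξ) ξ := fun T => by
      change ((‖T ξ‖ ^ 2 : ℝ) : ℂ) = inner ℂ (ContinuousLinearMap.adjoint T (T ξ)) ξ
      rw [ContinuousLinearMap.adjoint_inner_left, inner_self_eq_norm_sq_to_K]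
      norm_cast
    apply Complex.ofReal_injective
    rw [hn C, hsa, hCC, Complex.ofReal_sum, sum_apply, sum_inner]
    exact Finset.sum_congr rfl fun k _ => hn _
  rw [h2]
  refine pow_le_pow_left₀ (norm_nonneg _) ((C.le_opNorm ξ).trans ?_) 2
  gcongr

theorem sum_diff {H : Type*} [NormedAddCommGroup H] [InnerProductSpace ℂ H]
    (x : ℕ → (H →L[ℂ] H)) (n : ℕ) : ∑ k ∈ Finset.range (n + 1), diff x k = x n := by
  induction n with
  | zero => simp [diff]
  | succ n ih => rw [Finset.sum_range_succ, ih]; simp [diff]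

theorem norm_Ω (F : ℕ → VNState) : ‖Ω F‖ = 1 := by
  classical
  simp [Ω, lp.norm_single]

/-- Tested on the constant martingale `1`; this settles small `n` in the final bound. -/
theorem LowerEstimate.one_le {F : ℕ → VNState} {n : ℕ} {K : ℝ≥0} (h : LowerEstimate F n K)
    (hn : n ≠ 0) : (1 : ℝ) ≤ K := by
  have hx : IsFreeMartingale F fun _ => 1 :=
    ⟨fun n => one_mem _, fun n m _ => ⟨one_mem _, rfl⟩⟩
  have h1 := h.sum_le hx (Ω F)
  obtain ⟨N, hN⟩ : ∃ N, 2 * n = N + 1 := ⟨2 * n - 1, by omega⟩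
  have hnt : ‖(1 : Fock F →L[ℂ] Fock F)‖ ≤ 1 := ContinuousLinearMap.norm_id_le
  rw [hN, sum_diff, norm_Ω, Finset.sum_range_succ'] at h1
  have h2 : ‖diff (fun _ : ℕ => (1 : Fock F →L[ℂ] Fock F)) 0 (Ω F)‖ = 1 := by
    simp [diff, norm_Ω]
  rw [h2] at h1
  have h3 : (1 : ℝ) ≤ (K * ‖(1 : Fock F →L[ℂ] Fock F)‖ * 1) ^ 2 :=
    le_trans (by simpa using Finset.sum_nonneg fun _ _ => by positivity) h1
  have h4 := (one_le_sq_iff₀ (by positivity)).1 h3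
  have := mul_le_mul_of_nonneg_left hnt K.2
  change (K : ℝ) * _ ≤ K * 1 at this
  linarith

/-! ### Words `p N v` and products of three legs. -/

theorem cons_head {k : ℕ} (v : Tail family k) {j : ℕ} (h : k ≠ j) :
    ∀ p ∈ (cons k v).1.head?, p.1 ≠ j := by
  intro p hp
  have : p = (⟨k, ()⟩ : Σ k, (family k).ι) := by
    have h1 : (⟨k, ()⟩ : Σ k, (family k).ι) = p := Option.some.inj hp
    exact h1.symm
  rw [this]
  exact h

/-- A word beginning with `k`, considered as a word not beginning with `j ≠ k`. -/
def consTail {k j : ℕ} (h : k ≠ j) (v : Tail family k) : Tail family j := ⟨cons k v, cons_head v h⟩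

/-- The word `p N v`. -/
def wrap {N p : ℕ} (h : N ≠ p) (v : Tail family N) : Word family := cons p (consTail h v)

theorem cons_injective (k : ℕ) : Function.Injective (cons k) := fun v v' h => by
  have := (prepend_bijective (F := family) k).1 h
  exact (Prod.mk.inj this).2

theorem eq_of_cons_eq {j k : ℕ} {v : Tail family j} {v' : Tail family k}
    (h : cons j v = cons k v') : j = k := by
  by_contra hne
  exact cons_head v hne ⟨k, ()⟩ (by rw [h]; rfl) rfl

theorem wrap_injective {N p : ℕ} (h : N ≠ p) : Function.Injective (wrap h) := fun _ _ e =>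
  cons_injective N (congrArg Subtype.val (cons_injective p e))

theorem cons_mem_lowWords {k n : ℕ} (v : Tail family k) :
    cons k v ∈ lowWords family n ↔ k ≤ n ∧ v.1 ∈ lowWords family n := by
  change (∀ p ∈ (⟨k, ()⟩ :: v.1.1 : List (Σ k, (family k).ι)), p.1 ≤ n) ↔
    k ≤ n ∧ ∀ p ∈ v.1.1, p.1 ≤ n
  simp

theorem eq_tail_or_cons (k : ℕ) (w : Word family) : ∃ v : Tail family k, w = v.1 ∨ w = cons k v := by
  obtain ⟨⟨o, v⟩, rfl⟩ := (prepend_bijective (F := family) k).2 w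
  cases o with
  | none => exact ⟨v, Or.inl rfl⟩
  | some i => exact ⟨v, Or.inr rfl⟩

theorem norm_leftRep_le {F : ℕ → VNState} (k : ℕ) (a : (F k).H →L[ℂ] (F k).H) :
    ‖leftRep k a‖ ≤ ‖a‖ := by
  unfold leftRep
  exact LinearMap.mkContinuous_norm_le _ (norm_nonneg _) _

theorem norm_leg_le (k : ℕ) : ‖leg k 1 0‖ ≤ 1 := by
  have h1 : ‖leg k 1 0‖ ≤ ‖twoPointOp 1 0‖ :=
    norm_leftRep_le (F := family) k (twoPointOp 1 0)
  simpa using h1.trans (norm_twoPointOp_le 1)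

/-- Splits a generator into the projection onto words beginning with `k` and a flip. The parts serve
norm estimates only, so they need not lie in the algebra. -/
theorem leg_eq (k : ℕ) (r d : ℝ) : leg k r d = (d : ℂ) • leg k 0 1 + (r : ℂ) • leg k 1 0 := by
  ext x w
  change leg k r d x w = d * leg k 0 1 x w + r * leg k 1 0 x w
  obtain ⟨v, rfl | rfl⟩ := eq_tail_or_cons k w
  · simp [leg_apply_tail]
  · simp only [leg_apply_cons]
    push_cast
    ring

/-- The product of three operators acting on the legs `p`, `N`, `q`, the outer ones being flips. -/
def sandwich (p N q : ℕ) (r d : ℝ) : Fock family →L[ℂ] Fock family :=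
  leg p 1 0 * leg N r d * leg q 1 0

/-- At a word not beginning with `p`, the only contribution comes from the longer word `q N p v` and
carries the small factor `r`. -/
theorem sandwich_apply_tail {p N q : ℕ} (hp : p ≠ N) (hq : N ≠ q) (r d : ℝ) (ψ : Fock family)
    (v : Tail family p) : sandwich p N q r d ψ v.1 = r * ψ (wrap hq (consTail hp v)) := by
  change leg p 1 0 (leg N r d (leg q 1 0 ψ)) v.1 = _
  rw [leg_apply_tail]
  change _ * leg N r d (leg q 1 0 ψ) (consTail hp v).1 = _
  rw [leg_apply_tail]
  change _ * (_ * leg q 1 0 ψ (consTail hq (consTail hp v)).1) = _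
  rw [leg_apply_tail, wrap]
  simp

theorem sandwich_apply_wrap {p N q : ℕ} (hp : N ≠ p) (hq : N ≠ q) (r d : ℝ) (ψ : Fock family)
    (v : Tail family N) :
    sandwich p N q r d ψ (wrap hp v) = r * leg q 1 0 ψ v.1 + d * ψ (wrap hq v) := by
  change leg p 1 0 (leg N r d (leg q 1 0 ψ)) (wrap hp v) = _
  rw [wrap, leg_apply_cons]
  change _ * leg N r d (leg q 1 0 ψ) (cons N v) + _ = _
  rw [leg_apply_cons]
  have : leg q 1 0 ψ (cons N v) = ψ (wrap hq v) := by
    change leg q 1 0 ψ (consTail hq v).1 = _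
    rw [leg_apply_tail, wrap]
    simp
  rw [this]
  simp

/-- Together with `sandwich_apply_wrap` this makes the products with `r = 0`, `d = 1` matrix units
between the words `p N v` and `q N v`. -/
theorem sandwich_apply_of_notMem {p N q : ℕ} (hp : N ≠ p) (hq : N ≠ q) (ψ : Fock family)
    {w : Word family} (hw : w ∉ Set.range (wrap hp)) : sandwich p N q 0 1 ψ w = 0 := by
  obtain ⟨v, rfl | rfl⟩ := eq_tail_or_cons p w
  · rw [sandwich_apply_tail hp.symm hq]; simp
  · change leg p 1 0 (leg N 0 1 (leg q 1 0 ψ)) (cons p v) = 0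
    rw [leg_apply_cons]
    obtain ⟨u, hu | hu⟩ := eq_tail_or_cons N v.1
    · rw [hu, leg_apply_tail]; simp
    · refine absurd ⟨u, ?_⟩ hw
      rw [wrap]
      congr 1
      exact Subtype.ext hu.symm

theorem leg_mul_trunc {k n : ℕ} (hk : k ≤ n) (r d : ℝ) :
    leg k r d * trunc (lowWords family n) = trunc (lowWords family n) * leg k r d :=
  leftRep_mul_trunc (F := family) k _ (prepend_mem_lowWords hk) _

/-- A flip adds or removes the letter `k`, so it never maps a word with letters at most `n` to
another such word. -/
theorem trunc_mul_leg_mul_trunc {k n : ℕ} (hk : n < k) (r : ℝ) :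
    trunc (lowWords family n) * leg k r 0 * trunc (lowWords family n) = 0 := by
  ext x w
  change trunc (lowWords family n) (leg k r 0 (trunc (lowWords family n) x)) w = 0
  rw [trunc_apply]
  split_ifs with h
  · obtain ⟨v, rfl | rfl⟩ := eq_tail_or_cons k w
    · rw [leg_apply_tail, trunc_apply, if_neg, mul_zero]
      rw [cons_mem_lowWords]
      omega
    · rw [cons_mem_lowWords] at h
      omega
  · rfl

theorem trunc_mul_sandwich_mul_trunc {p N q n : ℕ} (hp : N < p) (hq : N < q)
    (h : ¬ (p ≤ n ∧ q ≤ n)) (r d : ℝ) :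
    trunc (lowWords family n) * sandwich p N q r d * trunc (lowWords family n) = 0 := by
  by_cases hpn : p ≤ n
  · have hqn : n < q := by omega
    have hNn : N ≤ n := by omega
    calc trunc (lowWords family n) * sandwich p N q r d * trunc (lowWords family n)
        -- The truncation commutes past the legs `p` and `N` and meets the flip at `q > n`, which it
        -- compresses to zero.
        = (trunc (lowWords family n) * leg p 1 0) * leg N r d * leg q 1 0 *
            trunc (lowWords family n) := by simp only [sandwich, mul_assoc]
      _ = leg p 1 0 * (trunc (lowWords family n) * leg N r d) * leg q 1 0 *
            trunc (lowWords family n) := by rw [← leg_mul_trunc hpn]; simp only [mul_assoc]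
      _ = leg p 1 0 * leg N r d * (trunc (lowWords family n) * leg q 1 0 *
            trunc (lowWords family n)) := by rw [← leg_mul_trunc hNn]; simp only [mul_assoc]
      _ = 0 := by rw [trunc_mul_leg_mul_trunc hqn, mul_zero]
  · ext x w
    change trunc (lowWords family n) (sandwich p N q r d (trunc (lowWords family n) x)) w = 0
    rw [trunc_apply]
    split_ifs with hw
    · obtain ⟨v, rfl | rfl⟩ := eq_tail_or_cons p w
      -- A low word cannot begin with `p > n`, and the coordinate it reads off belongs to `q N p v`,
      -- which contains `p`.
      · rw [sandwich_apply_tail hp.ne' hq.ne, trunc_apply, if_neg, mul_zero]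
        rw [wrap, cons_mem_lowWords]
        rintro ⟨-, h1⟩
        have h2 := (cons_mem_lowWords _).1 h1
        exact hpn ((cons_mem_lowWords _).1 h2.2).1
      · rw [cons_mem_lowWords] at hw
        omega
    · rfl

/-! ### The Hilbert martingale and its norm. -/

/-- Position of the middle factor. -/
def midIdx (m : ℕ) : ℕ := 2 * m + 1

/-- Positions of the outer factors. -/
def outIdx (m p : ℕ) : ℕ := 2 * (m + 1 + p)

theorem midIdx_lt_outIdx (m p : ℕ) : midIdx m < outIdx m p := by
  unfold midIdx outIdx; omega

theorem outIdx_injective (m : ℕ) : Function.Injective (outIdx m) := fun p q h => by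
  unfold outIdx at h; omega

/-- The matrix `1 / (p - q)` placed into the free product. -/
def hilbertSum (m : ℕ) (r d : ℝ) : Fock family →L[ℂ] Fock family :=
  ∑ p ∈ Finset.range m, ∑ q ∈ Finset.range m,
    HilbertInequality.kernel p q • sandwich (outIdx m p) (midIdx m) (outIdx m q) r d

/-- The free martingale with last term `hilbertSum`. -/
def hilbertMartingale (m n : ℕ) : Fock family →L[ℂ] Fock family :=
  ∑ p ∈ Finset.range m, ∑ q ∈ Finset.range m,
    if outIdx m p ≤ n ∧ outIdx m q ≤ n then HilbertInequality.kernel p q •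
      sandwich (outIdx m p) (midIdx m) (outIdx m q) (offEntry (midIdx m)) 1 else 0

theorem leg_mem_filtration {k n : ℕ} (h : k ≤ n) :
    leg k (offEntry k) (diagEntry k) ∈ filtration family n :=
  leftRep_mem_filtration (F := family) h (mem_vnGenerated rfl)

theorem leg_outIdx_mem_filtration {m p n : ℕ} (h : outIdx m p ≤ n) :
    leg (outIdx m p) 1 0 ∈ filtration family n := by
  have := leg_mem_filtration h
  have he : Even (outIdx m p) := even_two_mul _
  rwa [offEntry, diagEntry, if_pos he, if_pos he] at this

theorem leg_midIdx_mem_filtration {m n : ℕ} (h : midIdx m ≤ n) :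
    leg (midIdx m) (offEntry (midIdx m)) 1 ∈ filtration family n := by
  have := leg_mem_filtration h
  have he : ¬ Even (midIdx m) := by simp [midIdx]
  rwa [diagEntry, if_neg he] at this

/-- Termwise: an admissible product already lies in the smaller algebra because `midIdx` is below
both outer indices, and any other product is compressed to zero. -/
theorem isFreeMartingale_hilbertMartingale (m : ℕ) :
    IsFreeMartingale family (hilbertMartingale m) := by
  have hmem : ∀ n, hilbertMartingale m n ∈ filtration family n := by
    intro n
    refine sum_mem fun p _ => sum_mem fun q _ => ?_
    split_ifs with h
    · exact smul_mem_vonNeumannAlgebra _ _ (mul_mem (mul_mem (leg_outIdx_mem_filtration h.1)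
        (leg_midIdx_mem_filtration ((midIdx_lt_outIdx m p).le.trans h.1)))
        (leg_outIdx_mem_filtration h.2))
    · exact zero_mem _
  refine ⟨hmem, fun n l hnl => isCondExp_of_trunc (hmem n) ?_⟩
  simp only [hilbertMartingale, Finset.mul_sum, Finset.sum_mul]
  refine Finset.sum_congr rfl fun p _ => Finset.sum_congr rfl fun q _ => ?_
  by_cases h : outIdx m p ≤ n ∧ outIdx m q ≤ n
  · rw [if_pos h, if_pos ⟨h.1.trans hnl, h.2.trans hnl⟩]
  · rw [if_neg h, mul_zero, zero_mul]
    split_ifs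
    · rw [mul_smul_comm, smul_mul_assoc, trunc_mul_sandwich_mul_trunc (midIdx_lt_outIdx _ _)
        (midIdx_lt_outIdx _ _) h, smul_zero]
    · simp

theorem hilbertMartingale_eq {m n : ℕ} (h : 4 * m ≤ n) :
    hilbertMartingale m n = hilbertSum m (offEntry (midIdx m)) 1 := by
  refine Finset.sum_congr rfl fun p hp => Finset.sum_congr rfl fun q hq => if_pos ?_
  rw [Finset.mem_range] at hp hq
  unfold outIdx
  omega

theorem hilbertSum_eq (m : ℕ) (r d : ℝ) :
    hilbertSum m r d = (d : ℂ) • hilbertSum m 0 1 + (r : ℂ) • hilbertSum m 1 0 := by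
  simp only [hilbertSum, Finset.smul_sum, ← Finset.sum_add_distrib]
  refine Finset.sum_congr rfl fun p _ => Finset.sum_congr rfl fun q _ => ?_
  rw [sandwich, sandwich, sandwich, leg_eq _ r d]
  simp only [mul_add, add_mul, mul_smul_comm, smul_mul_assoc, smul_add]
  rw [smul_comm, smul_comm (r : ℂ)]

theorem norm_kernel_le (p q : ℕ) : ‖HilbertInequality.kernel p q‖ ≤ 1 := by
  rcases eq_or_ne p q with rfl | h
  · simp [HilbertInequality.kernel]
  · rw [HilbertInequality.kernel, norm_inv]
    refine inv_le_one_of_one_le₀ ?_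
    have h1 : ((p : ℂ) - q) = (((p : ℤ) - q : ℤ) : ℂ) := by push_cast; rfl
    rw [h1, Complex.norm_intCast]
    have : (p : ℤ) - q ≠ 0 := sub_ne_zero.2 (by exact_mod_cast h)
    exact_mod_cast Int.one_le_abs this

theorem norm_hilbertSum_flip_le (m : ℕ) : ‖hilbertSum m 1 0‖ ≤ (m : ℝ) ^ 2 := by
  have hterm : ∀ p q, ‖HilbertInequality.kernel p q •
      sandwich (outIdx m p) (midIdx m) (outIdx m q) 1 0‖ ≤ 1 := fun p q => by
    rw [norm_smul]
    refine mul_le_one₀ (norm_kernel_le p q) (norm_nonneg _) ?_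
    refine (norm_mul_le _ _).trans (mul_le_one₀ ((norm_mul_le _ _).trans ?_) (norm_nonneg _)
      (norm_leg_le _))
    exact mul_le_one₀ (norm_leg_le _) (norm_nonneg _) (norm_leg_le _)
  refine (norm_sum_le_of_le _ fun p _ => norm_sum_le_of_le _ fun q _ => hterm p q).trans ?_
  simp [sq]

theorem hilbertSum_apply_wrap (m : ℕ) (ψ : Fock family) (i : Fin m) (v : Tail family (midIdx m)) :
    hilbertSum m 0 1 ψ (wrap (midIdx_lt_outIdx m i).ne v) = ∑ q ∈ Finset.range m,
      HilbertInequality.kernel i q * ψ (wrap (midIdx_lt_outIdx m q).ne v) := by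
  simp only [hilbertSum, sum_apply, lp.coeFn_sum, Finset.sum_apply]
  rw [Finset.sum_eq_single (i : ℕ)]
  · refine Finset.sum_congr rfl fun q _ => ?_
    change _ * sandwich _ _ _ _ _ ψ _ = _
    rw [sandwich_apply_wrap (midIdx_lt_outIdx m i).ne (midIdx_lt_outIdx m q).ne]
    simp
  · intro p _ hp
    refine Finset.sum_eq_zero fun q _ => ?_
    change _ * sandwich _ _ _ _ _ ψ _ = _
    rw [sandwich_apply_of_notMem (midIdx_lt_outIdx m p).ne (midIdx_lt_outIdx m q).ne, mul_zero]
    rintro ⟨u, hu⟩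
    exact hp (outIdx_injective m (eq_of_cons_eq hu))
  · intro h
    exact absurd (Finset.mem_range.2 i.2) h

theorem hilbertSum_apply_of_notMem (m : ℕ) (ψ : Fock family) {w : Word family}
    (hw : ∀ (i : Fin m) (v : Tail family (midIdx m)), wrap (midIdx_lt_outIdx m i).ne v ≠ w) :
    hilbertSum m 0 1 ψ w = 0 := by
  simp only [hilbertSum, sum_apply, lp.coeFn_sum, Finset.sum_apply]
  refine Finset.sum_eq_zero fun p hp => Finset.sum_eq_zero fun q _ => ?_
  change _ * sandwich _ _ _ _ _ ψ _ = _
  rw [sandwich_apply_of_notMem (midIdx_lt_outIdx m p).ne (midIdx_lt_outIdx m q).ne, mul_zero]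
  rintro ⟨u, hu⟩
  exact hw ⟨p, Finset.mem_range.1 hp⟩ u hu

/-- For each tail `v` the words `p N v`, `p < m`, span an invariant block on which the operator is
the Hilbert matrix. These blocks are orthogonal and everything outside them is killed. -/
theorem norm_hilbertSum_proj_le (m : ℕ) : ‖hilbertSum m 0 1‖ ≤ Real.pi := by
  refine ContinuousLinearMap.opNorm_le_bound _ Real.pi_pos.le fun ψ => ?_
  refine le_of_sq_le_sq ?_ (mul_nonneg Real.pi_pos.le (norm_nonneg _))
  let e : Tail family (midIdx m) × Fin m → Word family :=
    fun b => wrap (midIdx_lt_outIdx m b.2).ne b.1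
  have he : Function.Injective e := by
    rintro ⟨v, i⟩ ⟨v', i'⟩ h
    have h1 : i = i' := Fin.ext (outIdx_injective m (eq_of_cons_eq h))
    subst h1
    exact Prod.ext (wrap_injective _ h) rfl
  obtain ⟨hs, hle⟩ := norm_coord_sq_sum_le ψ e he
  obtain ⟨hs', -⟩ := norm_coord_sq_sum_le (hilbertSum m 0 1 ψ) e he
  have hsupp : Function.support (fun w => ‖hilbertSum m 0 1 ψ w‖ ^ 2) ⊆ Set.range e := by
    intro w hw
    by_contra hne
    refine hw ?_
    have : hilbertSum m 0 1 ψ w = 0 :=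
      hilbertSum_apply_of_notMem m ψ fun i v h => hne ⟨(v, i), h⟩
    simp [this]
  rw [norm_sq_eq, ← he.tsum_eq hsupp, hs'.tsum_prod, mul_pow]
  refine le_trans ?_ (mul_le_mul_of_nonneg_left hle (by positivity))
  rw [hs.tsum_prod, ← tsum_mul_left]
  refine Summable.tsum_le_tsum (fun v => ?_) hs'.prod (hs.prod.mul_left _)
  rw [tsum_fintype, tsum_fintype]
  have h := HilbertInequality.sum_norm_sq_le (Finset.range m)
    fun q => ψ (wrap (midIdx_lt_outIdx m q).ne v)
  rw [Finset.sum_range, Finset.sum_range] at h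
  refine le_trans (le_of_eq ?_) h
  exact Finset.sum_congr rfl fun i _ => by rw [hilbertSum_apply_wrap]

theorem norm_hilbertMartingale_le {m n : ℕ} (h : 4 * m ≤ n) :
    ‖hilbertMartingale m n‖ ≤ Real.pi + 1 := by
  rw [hilbertMartingale_eq h, hilbertSum_eq]
  refine (norm_add_le _ _).trans (add_le_add ?_ ?_)
  · simpa using norm_hilbertSum_proj_le m
  -- The error is at most `m ^ 2 / (2 * m + 1) ^ 2 ≤ 1`.
  · have he : ¬ Even (midIdx m) := by simp [midIdx]
    rw [norm_smul, offEntry, if_neg he, Complex.norm_real, Real.norm_of_nonneg (by positivity)]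
    have h1 : (m : ℝ) ^ 2 ≤ (midIdx m : ℝ) ^ 2 := by
      gcongr
      unfold midIdx
      omega
    have h2 : (0 : ℝ) < (midIdx m : ℝ) ^ 2 := by
      have : 0 < midIdx m := by unfold midIdx; omega
      positivity
    rw [inv_mul_le_iff₀ h2, mul_one]
    exact (norm_hilbertSum_flip_le m).trans h1

/-! ### The test vector and the harmonic numbers. -/

/-- The empty word, considered as a word not beginning with `k`. -/
def emptyTail (k : ℕ) : Tail family k := ⟨emptyWord, fun p hp => by simp [emptyWord] at hp⟩

/-- The word with the letters `outIdx m q` and `midIdx m`. -/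
def testWord (m q : ℕ) : Word family := wrap (midIdx_lt_outIdx m q).ne (emptyTail (midIdx m))

theorem testWord_injective (m : ℕ) : Function.Injective (testWord m) := fun _ _ h =>
  outIdx_injective m (eq_of_cons_eq h)

theorem length_testWord (m q : ℕ) : (testWord m q).1.length = 2 := rfl

open Classical in
/-- The sum of the basis vectors of the test words. -/
def testVector (m : ℕ) : Fock family :=
  ∑ w ∈ (Finset.range m).image (testWord m), lp.single 2 w (1 : ℂ)

open Classical in
theorem testVector_apply (m : ℕ) (w : Word family) :
    testVector m w = if w ∈ (Finset.range m).image (testWord m) then 1 else 0 := by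
  simp only [testVector, lp.coeFn_sum, Finset.sum_apply, lp.single_apply, Pi.single_apply,
    Finset.sum_ite_eq]

theorem testVector_testWord {m q : ℕ} (hq : q < m) : testVector m (testWord m q) = 1 := by
  classical
  rw [testVector_apply, if_pos (Finset.mem_image_of_mem _ (Finset.mem_range.2 hq))]

theorem testVector_of_length_ne {m : ℕ} {w : Word family} (hw : w.1.length ≠ 2) :
    testVector m w = 0 := by
  classical
  rw [testVector_apply, if_neg]
  intro h
  obtain ⟨q, -, rfl⟩ := Finset.mem_image.1 h
  exact hw (length_testWord m q)

theorem norm_testVector_sq (m : ℕ) : ‖testVector m‖ ^ 2 = m := by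
  classical
  have h := lp.norm_sum_single (p := 2) (E := fun _ : Word family => ℂ) (by norm_num)
    (fun _ => (1 : ℂ)) ((Finset.range m).image (testWord m))
  simp only [ENNReal.toReal_ofNat, Real.rpow_ofNat, norm_one, one_pow, Finset.sum_const,
    nsmul_eq_mul, mul_one, Finset.card_image_of_injective _ (testWord_injective m),
    Finset.card_range] at h
  exact h

/-- Holds exactly for every `r`: the terms with factor `r` read coordinates at words of length one
or five, where the test vector vanishes. -/
theorem sandwich_testVector (m k p : ℕ) {q : ℕ} (hq : q < m) (r : ℝ) :
    sandwich (outIdx m p) (midIdx m) (outIdx m q) r 1 (testVector m) (testWord m k) =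
      if p = k then 1 else 0 := by
  have hpN := (midIdx_lt_outIdx m p).ne
  have hqN := (midIdx_lt_outIdx m q).ne
  split_ifs with h
  · subst h
    rw [testWord, sandwich_apply_wrap hpN hqN]
    have h1 : leg (outIdx m q) 1 0 (testVector m) (emptyTail (midIdx m)).1 = 0 := by
      change leg (outIdx m q) 1 0 (testVector m) (emptyTail (outIdx m q)).1 = 0
      rw [leg_apply_tail, testVector_of_length_ne, mul_zero]
      exact Nat.succ_ne_succ_iff.2 zero_ne_one
    have h2 : testVector m (wrap hqN (emptyTail (midIdx m))) = 1 := testVector_testWord hq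
    rw [h1, h2]
    simp
  · have hk : outIdx m k ≠ outIdx m p := fun e => h (outIdx_injective m e).symm
    have := sandwich_apply_tail hpN.symm hqN r 1 (testVector m)
      (consTail hk (consTail (midIdx_lt_outIdx m k).ne (emptyTail (midIdx m))))
    refine this.trans ?_
    rw [testVector_of_length_ne, mul_zero]
    -- The word in question is `q N p k N`.
    change (5 : ℕ) ≠ 2
    decide

theorem hilbertMartingale_testVector (m n : ℕ) {k : ℕ} (hk : k < m) :
    hilbertMartingale m n (testVector m) (testWord m k) = ∑ q ∈ Finset.range m,
      if outIdx m k ≤ n ∧ outIdx m q ≤ n then HilbertInequality.kernel k q else 0 := by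
  simp only [hilbertMartingale, sum_apply, lp.coeFn_sum, Finset.sum_apply]
  rw [Finset.sum_eq_single k]
  · refine Finset.sum_congr rfl fun q hq => ?_
    split_ifs
    · change _ * sandwich _ _ _ _ _ _ _ = _
      rw [sandwich_testVector m k k (Finset.mem_range.1 hq), if_pos rfl, mul_one]
    · rfl
  · intro p _ hp
    refine Finset.sum_eq_zero fun q hq => ?_
    split_ifs
    · change _ * sandwich _ _ _ _ _ _ _ = _
      rw [sandwich_testVector m k p (Finset.mem_range.1 hq), if_neg hp, mul_zero]
    · rfl
  · intro h
    exact absurd (Finset.mem_range.2 hk) h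

theorem sum_kernel_eq_harmonic (k : ℕ) :
    ∑ q ∈ Finset.range (k + 1), HilbertInequality.kernel k q = (harmonic k : ℂ) := by
  rw [Finset.sum_range_succ, ← Finset.sum_range_reflect, harmonic]
  push_cast
  simp only [HilbertInequality.kernel, sub_self, inv_zero, add_zero]
  refine Finset.sum_congr rfl fun j hj => ?_
  rw [Finset.mem_range] at hj
  have : ((k - 1 - j : ℕ) : ℂ) = k - 1 - j := by
    rw [Nat.sub_sub, Nat.cast_sub (by omega)]
    push_cast
    ring
  rw [this]
  congr 1
  ring

/-- Just before time `outIdx m k` row `k` is empty; at that time exactly its entries with `q ≤ k`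
are present, which is the lower triangle of the Hilbert matrix. -/
theorem diff_hilbertMartingale_testVector {m k : ℕ} (hk : k < m) :
    diff (hilbertMartingale m) (outIdx m k) (testVector m) (testWord m k) = (harmonic k : ℂ) := by
  obtain ⟨j, hj⟩ : ∃ j, outIdx m k = j + 1 := ⟨2 * (m + k) + 1, by unfold outIdx; ring⟩
  rw [hj]
  change hilbertMartingale m (j + 1) (testVector m) (testWord m k) -
    hilbertMartingale m j (testVector m) (testWord m k) = _
  rw [hilbertMartingale_testVector m _ hk, hilbertMartingale_testVector m _ hk, hj]
  simp only [add_le_iff_nonpos_right, nonpos_iff_eq_zero, one_ne_zero, false_and, if_false,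
    Finset.sum_const_zero, sub_zero, le_refl, true_and]
  rw [← sum_kernel_eq_harmonic, ← Finset.sum_filter]
  refine Finset.sum_congr (Finset.ext fun q => ?_) fun _ _ => rfl
  simp only [Finset.mem_filter, Finset.mem_range]
  unfold outIdx at hj ⊢
  omega

/-! ### The logarithmic lower bound. -/

theorem sum_harmonic_sq_le {n m : ℕ} (hm : 2 * m < n) {K : ℝ≥0}
    (h : LowerEstimate family n K) :
    ∑ k ∈ Finset.range m, (harmonic k : ℝ) ^ 2 ≤ (K * (Real.pi + 1)) ^ 2 * m := by
  have h1 := h.sum_le (isFreeMartingale_hilbertMartingale m) (testVector m)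
  obtain ⟨N, hN⟩ : ∃ N, 2 * n = N + 1 := ⟨2 * n - 1, by omega⟩
  rw [hN, sum_diff, mul_pow, norm_testVector_sq] at h1
  have h2 : (K * ‖hilbertMartingale m N‖) ^ 2 * m ≤ (K * (Real.pi + 1)) ^ 2 * m := by
    gcongr
    -- The largest outer index is `4 * m`, and `2 * m < n` gives `4 * m ≤ 2 * n - 1 = N`, so all
    -- terms are present.
    exact norm_hilbertMartingale_le (by omega)
  refine le_trans ?_ (h1.trans h2)
  calc ∑ k ∈ Finset.range m, (harmonic k : ℝ) ^ 2
      ≤ ∑ k ∈ Finset.range m, ‖diff (hilbertMartingale m) (outIdx m k) (testVector m)‖ ^ 2 := by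
        refine Finset.sum_le_sum fun k hk => ?_
        have := lp.norm_apply_le_norm two_ne_zero
          (diff (hilbertMartingale m) (outIdx m k) (testVector m)) (testWord m k)
        rw [diff_hilbertMartingale_testVector (Finset.mem_range.1 hk)] at this
        have e : ‖((harmonic k : ℚ) : ℂ)‖ = |(harmonic k : ℝ)| := by
          rw [← Complex.ofReal_ratCast, Complex.norm_real, Real.norm_eq_abs]
        rw [e] at this
        rw [← sq_abs]
        exact pow_le_pow_left₀ (abs_nonneg _) this 2
    _ = ∑ j ∈ (Finset.range m).image (outIdx m),
          ‖diff (hilbertMartingale m) j (testVector m)‖ ^ 2 :=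
        by rw [Finset.sum_image (outIdx_injective m).injOn]
    _ ≤ _ := by
        refine Finset.sum_le_sum_of_subset_of_nonneg (fun j hj => ?_) fun _ _ _ => by positivity
        obtain ⟨k, hk, rfl⟩ := Finset.mem_image.1 hj
        rw [Finset.mem_range] at hk ⊢
        unfold outIdx
        omega

theorem log_half_le {n m : ℕ} (hm : 2 * m < n) (hm2 : 2 ≤ m) {K : ℝ≥0}
    (h : LowerEstimate family n K) : Real.log (m / 2) ≤ 6 * K := by
  have h1 := sum_harmonic_sq_le hm h
  have hm2' : (2 : ℝ) ≤ m := by exact_mod_cast hm2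
  have hl : 0 ≤ Real.log (m / 2 : ℝ) := Real.log_nonneg (by linarith)
  -- Only the upper half of the range is kept; there each harmonic number is at least `log (m / 2)`.
  have h2 : (m / 2 : ℝ) * Real.log (m / 2) ^ 2 ≤ ∑ k ∈ Finset.range m, (harmonic k : ℝ) ^ 2 := by
    calc (m / 2 : ℝ) * Real.log (m / 2) ^ 2
        ≤ (Finset.Ico (m / 2) m).card * Real.log (m / 2) ^ 2 := by
          gcongr
          rw [Nat.card_Ico, Nat.cast_sub (Nat.div_le_self _ _)]
          have : ((m / 2 : ℕ) : ℝ) ≤ m / 2 := Nat.cast_div_le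
          linarith
      _ = ∑ k ∈ Finset.Ico (m / 2) m, Real.log (m / 2) ^ 2 := by simp
      _ ≤ ∑ k ∈ Finset.Ico (m / 2) m, (harmonic k : ℝ) ^ 2 := by
          refine Finset.sum_le_sum fun k hk => ?_
          refine pow_le_pow_left₀ hl (le_trans ?_ (log_add_one_le_harmonic k)) 2
          refine Real.log_le_log (by linarith) ?_
          rw [Finset.mem_Ico] at hk
          rw [div_le_iff₀ two_pos]
          exact_mod_cast (by omega : m ≤ (k + 1) * 2)
      _ ≤ _ := Finset.sum_le_sum_of_subset_of_nonneg
          (fun k hk => by rw [Finset.mem_Ico] at hk; exact Finset.mem_range.2 hk.2)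
          fun _ _ _ => by positivity
  have h3 : Real.log (m / 2) ^ 2 ≤ (6 * K : ℝ) ^ 2 := by
    -- Cancelling `m / 2` leaves `2 * (π + 1) ^ 2 ≤ 36`, the source of the constant `6`.
    have h4 : (K * (Real.pi + 1)) ^ 2 * 2 ≤ (6 * K : ℝ) ^ 2 := by
      have := Real.pi_lt_d2
      have : (Real.pi + 1) ^ 2 ≤ 18 := by nlinarith [Real.pi_pos]
      nlinarith [mul_le_mul_of_nonneg_left this (sq_nonneg (K : ℝ))]
    have h5 := h2.trans h1
    nlinarith
  exact le_of_sq_le_sq h3 (by positivity)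

theorem log_le_of_lowerEstimate (n : ℕ) {K : ℝ≥0} (h : LowerEstimate family n K) :
    1 / 12 * Real.log n ≤ K := by
  rcases eq_or_ne n 0 with rfl | hn
  · simp
  have hn' : (0 : ℝ) < n := by positivity
  rcases lt_or_ge n 36 with h36 | h36
  · have h1 := h.one_le hn
    have h2 : Real.log n ≤ 12 := by
      have h3 : Real.log n ≤ Real.log (6 ^ 2 : ℝ) :=
        Real.log_le_log hn' (by norm_num; exact_mod_cast h36.le)
      rw [Real.log_pow] at h3
      have := Real.log_le_sub_one_of_pos (show (0 : ℝ) < 6 by norm_num)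
      push_cast at h3
      linarith
    linarith
  · have h36' : (36 : ℝ) ≤ n := by exact_mod_cast h36
    have h1 := log_half_le (m := (n - 1) / 2) (by omega) (by omega) h
    have h2 : (n : ℝ) - 2 ≤ 2 * ((n - 1) / 2 : ℕ) := by
      have : n ≤ 2 * ((n - 1) / 2) + 2 := by omega
      have : (n : ℝ) ≤ 2 * ((n - 1) / 2 : ℕ) + 2 := by exact_mod_cast this
      linarith
    -- The threshold `36` gives `√n ≥ 6`, enough for `4 * √n ≤ n - 2`. Replacing `m / 2` by `√n`
    -- costs a factor `2` in the logarithm, so `6` becomes `12`.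
    have h3 : √(n : ℝ) ≤ ((n - 1) / 2 : ℕ) / 2 := by
      have h6 : (6 : ℝ) ≤ √(n : ℝ) := Real.le_sqrt_of_sq_le (by linarith)
      nlinarith [Real.sq_sqrt hn'.le]
    have h4 := Real.log_le_log (Real.sqrt_pos.2 hn') h3
    rw [Real.log_sqrt hn'.le] at h4
    linarith

end FreeProd

end

theorem theoremD :
    ∃ c : ℝ, 0 < c ∧
      (∀ n : ℕ, ENNReal.ofReal (c * Real.log n) ≤ FreeProd.bestConstant n) ∧
      ∃ F : ℕ → VNState,
        (∀ n : ℕ, ENNReal.ofReal (c * Real.log n) ≤ FreeProd.bestConstantOf F n) ∧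
        ¬ ∃ K : NNReal, ∀ n : ℕ, FreeProd.LowerEstimate F n K := by
  have key : ∀ (n : ℕ) (K : NNReal), FreeProd.LowerEstimate FreeProd.family n K →
      ENNReal.ofReal (1 / 12 * Real.log n) ≤ K := fun n K h => by
    rw [← ENNReal.ofReal_coe_nnreal]
    exact ENNReal.ofReal_le_ofReal (FreeProd.log_le_of_lowerEstimate n h)
  refine ⟨1 / 12, by norm_num, fun n => le_iInf₂ fun K h => key n K (h _), FreeProd.family,
    fun n => le_iInf₂ fun K h => key n K h, ?_⟩
  rintro ⟨K, h⟩
  obtain ⟨n, hn⟩ := ((Real.tendsto_log_atTop.comp tendsto_natCast_atTop_atTop).eventually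
    (Filter.eventually_gt_atTop (12 * (K : ℝ)))).exists
  have h1 := FreeProd.log_le_of_lowerEstimate n (h n)
  simp only [Function.comp_apply] at hn
  linarith
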